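/- Let $n\ge 1$ be odd and let $D\subset\mathbb R^n$ be a bounded domain (a nonempty connected open set) with $C^\infty$ boundary; that is, near each boundary point $D$ is the set $\{\rho<0\}$ of a $C^\infty$ function $\rho$ whose differential does not vanish at that point. For a unit vector $\omega\in S^{n-1}$ and $t\in\mathbb R$ let $V_D(\omega,t)$ denote the $(n-1)$-dimensional volume of the section $D\cap\{x\in\mathbb R^n:\langle\omega,x\rangle=t\}$. Suppose that $D$ is polynomially integrable: there are an integer $N\ge 0$ and functions $a_0,\dots,a_N:S^{n-1}\to\mathbb R$ (no regularity assumed) such that $$V_D(\omega,t)=\sum_{j=0}^N a_j(\omega)\,t^j$$ for all $\omega\in S^{n-1}$ and all $t\in\mathbb R$ for which the hyperplane $\{\langle\omega,x\rangle=t\}$ meets $D$. Then $D$ is convex. -/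

import Mathlib

open Set MeasureTheory

noncomputable section

/-- The hyperplane `⟨ω, x⟩ = t` in `ℝⁿ`. -/
def hyperplane {n : ℕ} (ω : EuclideanSpace ℝ (Fin n)) (t : ℝ) : Set (EuclideanSpace ℝ (Fin n)) :=
  {x | inner ℝ ω x = t}

/-- The section-volume function `V_D(ω, t)`: the `(n-1)`-dimensional Euclidean volume of the
section of `D` by the hyperplane `⟨ω, x⟩ = t`. The measure `μHE[n - 1]` is the Hausdorff measure
normalized so that it restricts to Lebesgue measure on hyperplanes. -/
def sectionVolume {n : ℕ} (D : Set (EuclideanSpace ℝ (Fin n)))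
    (ω : EuclideanSpace ℝ (Fin n)) (t : ℝ) : ℝ :=
  (μHE[n - 1] (D ∩ hyperplane ω t)).toReal

/-- The boundary of `D` is `C^∞`: near each boundary point, `D` is the negativity set of a `C^∞`
function whose differential does not vanish at that point. -/
def HasSmoothBoundary {n : ℕ} (D : Set (EuclideanSpace ℝ (Fin n))) : Prop :=
  ∀ p ∈ frontier D, ∃ (U : Set (EuclideanSpace ℝ (Fin n))) (ρ : EuclideanSpace ℝ (Fin n) → ℝ),
    IsOpen U ∧ p ∈ U ∧ ContDiffOn ℝ ((⊤ : ℕ∞) : WithTop ℕ∞) ρ U ∧ fderiv ℝ ρ p ≠ 0 ∧ D ∩ U = {x ∈ U | ρ x < 0}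

/-- A bounded domain (nonempty connected open set) in `ℝⁿ` with `C^∞` boundary. -/
structure IsSmoothlyBoundedDomain {n : ℕ} (D : Set (EuclideanSpace ℝ (Fin n))) : Prop where
  isOpen : IsOpen D
  isConnected : IsConnected D
  isBounded : Bornology.IsBounded D
  smoothBoundary : HasSmoothBoundary D

/-- `D` is polynomially integrable: for some `N` and some functions `a₀, …, a_N` on the unit
sphere (arbitrary: no regularity in `ω` is required), `V_D(ω, t) = ∑ a_j(ω) t ^ j` for all unit
vectors `ω` and all `t` such that the hyperplane `⟨ω, x⟩ = t` hits `D`. -/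
def PolynomiallyIntegrable {n : ℕ} (D : Set (EuclideanSpace ℝ (Fin n))) : Prop :=
  ∃ (N : ℕ) (a : ℕ → Metric.sphere (0 : EuclideanSpace ℝ (Fin n)) 1 → ℝ),
    ∀ (ω : Metric.sphere (0 : EuclideanSpace ℝ (Fin n)) 1) (t : ℝ),
      (D ∩ hyperplane (ω : EuclideanSpace ℝ (Fin n)) t).Nonempty →
        sectionVolume D (ω : EuclideanSpace ℝ (Fin n)) t
          = ∑ j ∈ Finset.range (N + 1), a j ω * t ^ j

end

/-!
The proof is a localized form of the inversion of the Radon transform in odd dimension. It shows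
that no boundary point of `D` lies in the convex hull of `D`; then `D` is open and relatively
closed in its convex hull, which is connected, and so equals it.

Take a compactly supported `k : ℝ → ℝ`, an order `m > max(N, n)`, and superpose the plane waves
`x ↦ k⁽ᵐ⁾(⟨x, ω⟩)` over all `ω` in an annulus. In odd dimension the distribution of `⟨x, ω⟩` has a
polynomial density near the origin, because the section volume of a ball is a multiple of
`(r² - t²) ^ ((n-1)/2)`, and `k⁽ᵐ⁾` annihilates polynomials of degree below `m`; hence this kernel
`Ψ` has compact support (`planeWaveKernel_eq_zero_of_one_lt_norm`). It is continuous, rotation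
invariant, and nonzero at the origin if `k⁽ᵐ⁾(0) ≠ 0`.

Let `p` be a point of the open set `convexHull ℝ D`. As `D` is connected, every hyperplane passing
near `p` meets `D`, so its section volume is given by the polynomial formula. Slicing `D` along each
wave, the rescaled kernels `Ψ(l⁻¹(y - p) - z)` with small `l > 0` integrate to zero over `D`
(`setIntegral_planeWaveKernel_eq_zero`). If `p` were also a boundary point of `D`, letting `l → 0`
would replace `D` by its tangent half-space (`setIntegral_halfSpace_eq_zero_of_blowup`), so by
translation and rotation the integral of `Ψ` over every half-space would vanish. Then the Fourier
transform of `Ψ` vanishes, so `Ψ = 0` (`eq_zero_of_setIntegral_halfSpace_eq_zero`), contradicting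
`Ψ 0 ≠ 0`.

The coefficients enter only for one fixed `ω` at a time, so their regularity plays no role.
-/

open Filter Topology

/-! ### Slicing by parallel hyperplanes -/

lemma hyperplane_eq_mk' {n : ℕ} {e : EuclideanSpace ℝ (Fin n)} (he : ‖e‖ = 1) (t : ℝ) :
    hyperplane e t = AffineSubspace.mk' (t • e) (ℝ ∙ e)ᗮ := by
  ext x
  simp [hyperplane, AffineSubspace.mem_mk', Submodule.mem_orthogonal_singleton_iff_inner_right,
    inner_sub_right, inner_smul_right, he, sub_eq_zero]

/-- The `(n-1)`-dimensional measure of a hyperplane section, as a Lebesgue volume in `eᗮ`. -/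
lemma euclideanHausdorffMeasure_inter_hyperplane {n : ℕ} {e : EuclideanSpace ℝ (Fin n)}
    (he : ‖e‖ = 1) (S : Set (EuclideanSpace ℝ (Fin n))) (t : ℝ) :
    μHE[n - 1] (S ∩ hyperplane e t)
      = volume ((fun y : (ℝ ∙ e)ᗮ => t • e + (y : EuclideanSpace ℝ (Fin n))) ⁻¹' S) := by
  have he0 : e ≠ 0 := by rintro rfl; simp at he
  have hrank : Module.finrank ℝ (ℝ ∙ e)ᗮ = n - 1 := by
    have h := (ℝ ∙ e).finrank_add_finrank_orthogonal
    rw [finrank_span_singleton he0, finrank_euclideanSpace_fin] at h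
    omega
  have hiso : Isometry (fun y : (ℝ ∙ e)ᗮ => t • e + (y : EuclideanSpace ℝ (Fin n))) :=
    (IsometryEquiv.constVAdd (t • e)).isometry.comp isometry_subtype_coe
  rw [← InnerProductSpace.euclideanHausdorffMeasure_eq_volume, hrank,
    hiso.euclideanHausdorffMeasure_preimage, hyperplane_eq_mk' he]
  congr 2
  ext x
  simp only [SetLike.mem_coe, AffineSubspace.mem_mk', mem_range, vsub_eq_sub]
  constructor
  · intro h
    exact ⟨⟨_, h⟩, by simp⟩
  · rintro ⟨y, rfl⟩
    simp

lemma measurable_euclideanHausdorffMeasure_inter_hyperplane {n : ℕ}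
    {e : EuclideanSpace ℝ (Fin n)} (he : ‖e‖ = 1) {S : Set (EuclideanSpace ℝ (Fin n))}
    (hS : MeasurableSet S) : Measurable fun t => μHE[n - 1] (S ∩ hyperplane e t) := by
  simp_rw [euclideanHausdorffMeasure_inter_hyperplane he]
  have hm : Measurable fun q : ℝ × (ℝ ∙ e)ᗮ => q.1 • e + (q.2 : EuclideanSpace ℝ (Fin n)) := by
    fun_prop
  exact measurable_measure_prodMk_left (hm hS)

lemma euclideanHausdorffMeasure_inter_hyperplane_lt_top {n : ℕ}
    {e : EuclideanSpace ℝ (Fin n)} (he : ‖e‖ = 1) {S : Set (EuclideanSpace ℝ (Fin n))}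
    (hS : Bornology.IsBounded S) (t : ℝ) : μHE[n - 1] (S ∩ hyperplane e t) < ⊤ := by
  rw [euclideanHausdorffMeasure_inter_hyperplane he]
  have hiso : Isometry (fun y : (ℝ ∙ e)ᗮ => t • e + (y : EuclideanSpace ℝ (Fin n))) :=
    (IsometryEquiv.constVAdd (t • e)).isometry.comp isometry_subtype_coe
  exact (hiso.antilipschitz.isBounded_preimage hS).measure_lt_top

/-- Fubini for slices: the push-forward of Lebesgue measure on `S` under `⟨e, ·⟩` has the
section measure as its density. -/
lemma map_inner_restrict_eq_withDensity {n : ℕ} {e : EuclideanSpace ℝ (Fin n)} (he : ‖e‖ = 1)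
    {S : Set (EuclideanSpace ℝ (Fin n))} (hS : MeasurableSet S) :
    (volume.restrict S).map (fun x => inner ℝ e x)
      = volume.withDensity fun t => μHE[n - 1] (S ∩ hyperplane e t) := by
  have he0 : e ≠ 0 := by rintro rfl; simp at he
  have hme : Measurable fun x : EuclideanSpace ℝ (Fin n) => inner ℝ e x := by fun_prop
  ext B hB
  rw [Measure.map_apply hme hB, withDensity_apply _ hB, Measure.restrict_apply (hme hB),
    ← InnerProductSpace.euclideanHausdorffMeasure_eq_volume,
    EuclideanGeometry.euclideanHausdorffMeasure_eq_lintegral (0 : EuclideanSpace ℝ (Fin n)) he0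
      ((hme hB).inter hS), ← lintegral_indicator hB]
  have : ‖e‖ₑ = 1 := by simp [enorm_eq_nnnorm, ← NNReal.coe_inj, he]
  rw [this, one_mul]
  refine lintegral_congr fun t => ?_
  simp only [finrank_euclideanSpace_fin, vadd_eq_add, add_zero, ← hyperplane_eq_mk' he]
  by_cases ht : t ∈ B
  · rw [indicator_of_mem ht]
    congr 1
    ext x
    simp only [mem_inter_iff, mem_preimage, hyperplane, mem_ofPred_eq]
    constructor
    · tauto
    · rintro ⟨h1, h2⟩
      exact ⟨⟨by rwa [h2], h1⟩, h2⟩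
  · rw [indicator_of_notMem ht]
    convert measure_empty
    · ext x
      simp only [mem_inter_iff, mem_preimage, hyperplane, mem_ofPred_eq, mem_empty_iff_false,
        iff_false]
      rintro ⟨⟨h1, -⟩, h2⟩
      exact ht (h2 ▸ h1)
    · infer_instance

/-- Integration of a plane wave over `S`, slice by slice. -/
lemma setIntegral_comp_inner {n : ℕ} {e : EuclideanSpace ℝ (Fin n)} (he : ‖e‖ = 1)
    {S : Set (EuclideanSpace ℝ (Fin n))} (hS : MeasurableSet S) (hb : Bornology.IsBounded S)
    {g : ℝ → ℝ} (hg : Continuous g) :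
    ∫ x in S, g (inner ℝ e x) = ∫ t, sectionVolume S e t * g t := by
  have hme : Measurable fun x : EuclideanSpace ℝ (Fin n) => inner ℝ e x := by fun_prop
  rw [← integral_map (μ := volume.restrict S) hme.aemeasurable hg.aestronglyMeasurable,
    map_inner_restrict_eq_withDensity he hS, integral_withDensity_eq_integral_toReal_smul
      (measurable_euclideanHausdorffMeasure_inter_hyperplane he hS)
      (.of_forall fun t => euclideanHausdorffMeasure_inter_hyperplane_lt_top he hb t)]
  rfl

/-- In odd dimension the section volume of a ball is a polynomial in the offset, as long as the
hyperplane meets the ball: `(r² - t²) ^ ((n-1)/2)` with an integral exponent. -/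
lemma exists_polynomial_sectionVolume_ball {n : ℕ} (hn : Odd n) {e : EuclideanSpace ℝ (Fin n)}
    (he : ‖e‖ = 1) (r : ℝ) :
    ∃ Q : Polynomial ℝ, Q.natDegree ≤ n ∧
      ∀ t, |t| < r → sectionVolume (Metric.ball 0 r) e t = Q.eval t := by
  obtain ⟨p, rfl⟩ := hn
  have he0 : e ≠ 0 := by rintro rfl; simp at he
  have hrank : Module.finrank ℝ (ℝ ∙ e)ᗮ = 2 * p := by
    have h := (ℝ ∙ e).finrank_add_finrank_orthogonal
    rw [finrank_span_singleton he0, finrank_euclideanSpace_fin] at h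
    omega
  refine ⟨Polynomial.C (volume (Metric.ball (0 : (ℝ ∙ e)ᗮ) 1)).toReal
    * (Polynomial.C (r ^ 2) - Polynomial.X ^ 2) ^ p, ?_, fun t ht => ?_⟩
  · refine (Polynomial.natDegree_C_mul_le _ _).trans (Polynomial.natDegree_pow_le.trans ?_)
    have : (Polynomial.C (r ^ 2) - Polynomial.X ^ 2 : Polynomial ℝ).natDegree ≤ 2 := by
      compute_degree
    nlinarith
  · have hpos : 0 < r ^ 2 - t ^ 2 := by
      have := sq_lt_sq' (neg_lt_of_abs_lt ht) (lt_of_abs_lt ht)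
      linarith
    have hball : (fun y : (ℝ ∙ e)ᗮ => t • e + (y : EuclideanSpace ℝ (Fin (2 * p + 1)))) ⁻¹'
        Metric.ball 0 r = Metric.ball 0 (Real.sqrt (r ^ 2 - t ^ 2)) := by
      ext y
      have hy : inner ℝ e (y : EuclideanSpace ℝ (Fin (2 * p + 1))) = 0 :=
        Submodule.mem_orthogonal_singleton_iff_inner_right.1 y.2
      have hr : 0 ≤ r := (abs_nonneg t).trans ht.le
      have hnorm : ‖t • e + (y : EuclideanSpace ℝ (Fin (2 * p + 1)))‖ ^ 2 = t ^ 2 + ‖y‖ ^ 2 := by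
        rw [norm_add_sq_real, norm_smul, he, inner_smul_left, hy]
        simp
      simp only [mem_preimage, mem_ball_zero_iff]
      rw [Real.lt_sqrt (norm_nonneg _), ← sq_lt_sq₀ (norm_nonneg _) hr, hnorm]
      constructor <;> intro <;> linarith
    rw [sectionVolume, euclideanHausdorffMeasure_inter_hyperplane he, hball,
      Measure.addHaar_ball_of_pos _ _ (Real.sqrt_pos.2 hpos), hrank, ENNReal.toReal_mul,
      ENNReal.toReal_ofReal (by positivity), pow_mul, Real.sq_sqrt hpos.le]
    simp [mul_comm]

/-! ### High derivatives of test functions annihilate polynomials -/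

lemma integral_iteratedDeriv_mul_polynomial_eq_zero {m : ℕ} {k : ℝ → ℝ} (hk : ContDiff ℝ m k)
    (hsupp : HasCompactSupport k) {Q : Polynomial ℝ} (hQ : Q.natDegree < m) :
    ∫ t, iteratedDeriv m k t * Q.eval t = 0 := by
  induction m generalizing Q with
  | zero => omega
  | succ m ih =>
    have hcs : ∀ j, HasCompactSupport (iteratedDeriv j k) := fun j => by
      induction j with
      | zero => simpa using hsupp
      | succ j hj => rw [iteratedDeriv_succ]; exact hj.deriv
    have hd : ∀ t, HasDerivAt (iteratedDeriv m k) (iteratedDeriv (m + 1) k t) t := fun t => by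
      rw [iteratedDeriv_succ]
      exact ((hk.differentiable_iteratedDeriv m (by exact_mod_cast m.lt_succ_self)) t).hasDerivAt
    have hc : Continuous (iteratedDeriv m k) := hk.continuous_iteratedDeriv m (by simp)
    have hc' : Continuous (iteratedDeriv (m + 1) k) := hk.continuous_iteratedDeriv (m + 1) le_rfl
    have hparts := integral_mul_deriv_eq_deriv_mul_of_integrable
      (u := fun t => Q.eval t) (u' := fun t => Q.derivative.eval t)
      (v := iteratedDeriv m k) (v' := iteratedDeriv (m + 1) k)
      (fun t _ => Q.hasDerivAt t) (fun t _ => hd t)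
      ((Q.continuous.mul hc').integrable_of_hasCompactSupport (hcs _).mul_left)
      ((Q.derivative.continuous.mul hc).integrable_of_hasCompactSupport (hcs _).mul_left)
      ((Q.continuous.mul hc).integrable_of_hasCompactSupport (hcs _).mul_left)
    simp_rw [mul_comm (iteratedDeriv (m + 1) k _)]
    rw [hparts, neg_eq_zero]
    rcases Nat.eq_zero_or_pos Q.natDegree with h0 | h0
    · rw [Polynomial.derivative_of_natDegree_zero h0]
      simp
    · simp_rw [mul_comm (Polynomial.eval _ _)]
      exact ih (hk.of_le (by exact_mod_cast m.le_succ))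
        ((Polynomial.natDegree_derivative_lt h0.ne').trans_le (by omega))

/-- The form in which the annihilation of polynomials is used: the weight `w` need only agree
with a polynomial of degree less than `m` on the support of the rescaled test function. -/
lemma integral_mul_iteratedDeriv_comp_affine_eq_zero {m : ℕ} {k : ℝ → ℝ} (hk : ContDiff ℝ m k)
    (hsupp : HasCompactSupport k) {Q : Polynomial ℝ} (hQ : Q.natDegree < m) {w : ℝ → ℝ} {a b : ℝ}
    (ha : a ≠ 0) (hw : ∀ t, iteratedDeriv m k (a * t + b) ≠ 0 → w t = Q.eval t) :
    ∫ t, w t * iteratedDeriv m k (a * t + b) = 0 := by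
  set R : Polynomial ℝ := Q.comp (Polynomial.C a⁻¹ * (Polynomial.X - Polynomial.C b)) with hR
  have hRdeg : R.natDegree < m := by
    refine lt_of_le_of_lt (Polynomial.natDegree_comp_le.trans ?_) hQ
    have : (Polynomial.C a⁻¹ * (Polynomial.X - Polynomial.C b) : Polynomial ℝ).natDegree ≤ 1 := by
      compute_degree
    nlinarith
  have hcongr : ∀ t, w t * iteratedDeriv m k (a * t + b)
      = (fun s => (fun u => iteratedDeriv m k u * R.eval u) (s + b)) (a * t) := fun t => by
    have hRe : R.eval (a * t + b) = Q.eval t := by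
      simp [hR, ha]
    simp only [hRe]
    by_cases h : iteratedDeriv m k (a * t + b) = 0
    · simp [h]
    · rw [hw t h, mul_comm]
  simp_rw [hcongr]
  rw [Measure.integral_comp_mul_left (fun s => (fun u => iteratedDeriv m k u * R.eval u) (s + b)) a,
    integral_add_right_eq_self (fun u => iteratedDeriv m k u * R.eval u) b,
    integral_iteratedDeriv_mul_polynomial_eq_zero hk hsupp hRdeg, smul_zero]

/-- A bump function times `x ^ m`: its `m`-th derivative at the origin is `m!`. -/
lemma exists_contDiff_iteratedDeriv_ne_zero (m : ℕ) :
    ∃ k : ℝ → ℝ, ContDiff ℝ m k ∧ HasCompactSupport k ∧ iteratedDeriv m k 0 ≠ 0 ∧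
      ∀ t, iteratedDeriv m k t ≠ 0 → |t| ≤ 1 := by
  let f : ContDiffBump (0 : ℝ) := ⟨1 / 2, 1, by norm_num, by norm_num⟩
  have hcd : ContDiff ℝ m fun x => f x * x ^ m := f.contDiff.mul (contDiff_id.pow m)
  have hts : tsupport (fun x => f x * x ^ m) ⊆ Metric.closedBall 0 1 :=
    (tsupport_mul_subset_left).trans f.tsupport_eq.subset
  refine ⟨fun x => f x * x ^ m, hcd, f.hasCompactSupport.mul_right, ?_, fun t ht => ?_⟩
  · have h : (fun x => f x * x ^ m) =ᶠ[nhds 0] fun x => x ^ m := by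
      filter_upwards [f.eventuallyEq_one] with x hx
      simp [hx]
    rw [h.iteratedDeriv_eq, iteratedDeriv_fun_pow_zero]
    simp [Nat.factorial_ne_zero]
  · rw [← norm_ne_zero_iff, ← norm_iteratedFDeriv_eq_norm_iteratedDeriv, norm_ne_zero_iff] at ht
    simpa using hts (support_iteratedFDeriv_subset m ht)

/-! ### The plane-wave kernel -/

/-- The superposition `x ↦ ∫ g(⟨x, ω⟩) dω` of plane waves of profile `g`, the frequency `ω`
running over the annulus `1 ≤ ‖ω‖ < 2`. The annulus plays the role of the unit sphere: it is
rotation invariant and stays away from `ω = 0`, where the waves would spread out. -/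
noncomputable def planeWaveKernel {n : ℕ} (g : ℝ → ℝ) (x : EuclideanSpace ℝ (Fin n)) : ℝ :=
  ∫ ω in Metric.ball (0 : EuclideanSpace ℝ (Fin n)) 2 \ Metric.ball 0 1, g (inner ℝ x ω)

section PlaneWaveKernel

variable {n : ℕ} {g : ℝ → ℝ}

lemma continuous_planeWaveKernel (hg : Continuous g) {C : ℝ} (hC : ∀ t, |g t| ≤ C) :
    Continuous (planeWaveKernel (n := n) g) := by
  refine continuous_of_dominated (bound := fun _ => C)
    (fun x => (by fun_prop : Continuous fun ω => g (inner ℝ x ω)).aestronglyMeasurable)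
    (fun x => .of_forall fun ω => hC _) ?_ (.of_forall fun ω => by fun_prop)
  have : IsFiniteMeasure (volume.restrict
      (Metric.ball (0 : EuclideanSpace ℝ (Fin n)) 2 \ Metric.ball 0 1)) :=
    ⟨by simpa using (measure_mono sdiff_subset).trans_lt measure_ball_lt_top⟩
  exact integrable_const C

lemma planeWaveKernel_map_linearIsometryEquiv
    (T : EuclideanSpace ℝ (Fin n) ≃ₗᵢ[ℝ] EuclideanSpace ℝ (Fin n))
    (x : EuclideanSpace ℝ (Fin n)) : planeWaveKernel g (T x) = planeWaveKernel g x := by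
  rw [planeWaveKernel, planeWaveKernel, ← T.measurePreserving.setIntegral_preimage_emb
    T.toHomeomorph.measurableEmbedding]
  have hpre : T ⁻¹' (Metric.ball 0 2 \ Metric.ball 0 1) = Metric.ball 0 2 \ Metric.ball 0 1 := by
    ext ω
    simp
  simp [hpre]

lemma planeWaveKernel_zero_ne_zero (hn : 0 < n) (hg : g 0 ≠ 0) :
    planeWaveKernel g (0 : EuclideanSpace ℝ (Fin n)) ≠ 0 := by
  have : Nonempty (Fin n) := ⟨⟨0, hn⟩⟩
  have hsub : Metric.ball (0 : EuclideanSpace ℝ (Fin n)) 1 ⊆ Metric.ball 0 2 :=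
    Metric.ball_subset_ball (by norm_num)
  have hvol : volume.real (Metric.ball (0 : EuclideanSpace ℝ (Fin n)) 2 \ Metric.ball 0 1) ≠ 0 := by
    rw [measureReal_sdiff hsub measurableSet_ball measure_ball_lt_top.ne,
      measureReal_def, Measure.addHaar_ball_of_pos _ _ two_pos, ENNReal.toReal_mul,
      ENNReal.toReal_ofReal (by positivity), finrank_euclideanSpace_fin, ← measureReal_def]
    have h1 : 0 < volume.real (Metric.ball (0 : EuclideanSpace ℝ (Fin n)) 1) :=
      ENNReal.toReal_pos (Metric.measure_ball_pos _ _ one_pos).ne' measure_ball_lt_top.ne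
    have h2 : (1 : ℝ) < 2 ^ n := one_lt_pow₀ (by norm_num) hn.ne'
    nlinarith
  simp [planeWaveKernel, hg, hvol]

/-- Huygens' principle in odd dimension: a plane-wave kernel whose profile is a high derivative
of a function supported in `[-1, 1]` is supported in the unit ball. On the support of the profile
the distribution of `⟨x, ω⟩` has a polynomial density, which the profile annihilates. -/
lemma planeWaveKernel_eq_zero_of_one_lt_norm (hn : Odd n) {m : ℕ} {k : ℝ → ℝ}
    (hk : ContDiff ℝ m k) (hsupp : HasCompactSupport k) (hm : n < m)
    (hk1 : ∀ t, iteratedDeriv m k t ≠ 0 → |t| ≤ 1) {x : EuclideanSpace ℝ (Fin n)}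
    (hx : 1 < ‖x‖) : planeWaveKernel (iteratedDeriv m k) x = 0 := by
  have hx0 : ‖x‖ ≠ 0 := by positivity
  have hgc : Continuous (iteratedDeriv m k) := hk.continuous_iteratedDeriv m le_rfl
  have he : ‖‖x‖⁻¹ • x‖ = 1 := by rw [norm_smul, norm_inv, norm_norm, inv_mul_cancel₀ hx0]
  -- both balls bounding the annulus contribute zero
  have hball : ∀ r : ℝ, 1 ≤ r →
      ∫ ω in Metric.ball (0 : EuclideanSpace ℝ (Fin n)) r,
        iteratedDeriv m k (inner ℝ x ω) = 0 := fun r hr => by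
    have hrw : ∀ ω, iteratedDeriv m k (inner ℝ x ω)
        = (fun t => iteratedDeriv m k (‖x‖ * t + 0)) (inner ℝ (‖x‖⁻¹ • x) ω) := fun ω => by
      simp only [real_inner_smul_left, add_zero]
      rw [mul_inv_cancel_left₀ hx0]
    simp_rw [hrw]
    rw [setIntegral_comp_inner (g := fun t => iteratedDeriv m k (‖x‖ * t + 0)) he
      measurableSet_ball Metric.isBounded_ball (by fun_prop)]
    obtain ⟨Q, hQdeg, hQ⟩ := exists_polynomial_sectionVolume_ball hn he r
    refine integral_mul_iteratedDeriv_comp_affine_eq_zero hk hsupp (hQdeg.trans_lt hm) hx0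
      fun t ht => hQ t ?_
    have h1 := hk1 _ ht
    rw [add_zero, abs_mul, abs_norm] at h1
    have : |t| < 1 := by
      by_contra! h
      nlinarith
    linarith
  have hint : IntegrableOn (fun ω => iteratedDeriv m k (inner ℝ x ω))
      (Metric.ball (0 : EuclideanSpace ℝ (Fin n)) 2) :=
    ((by fun_prop : Continuous fun ω => iteratedDeriv m k (inner ℝ x ω)).continuousOn
      |>.integrableOn_compact (isCompact_closedBall _ _)).mono_set Metric.ball_subset_closedBall
  rw [planeWaveKernel, setIntegral_sdiff measurableSet_ball hint
    (Metric.ball_subset_ball (by norm_num)), hball 2 (by norm_num), hball 1 le_rfl, sub_zero]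

end PlaneWaveKernel

/-! ### Functions with vanishing half-space integrals -/

/-- A continuous integrable function whose integrals over all half-spaces vanish is zero: its
positive and negative parts, as measures, have the same one-dimensional marginals. -/
lemma eq_zero_of_setIntegral_halfSpace_eq_zero {n : ℕ} (hn : 0 < n) {f : EuclideanSpace ℝ (Fin n) → ℝ}
    (hf : Continuous f) (hfi : Integrable f)
    (h : ∀ e : EuclideanSpace ℝ (Fin n), ‖e‖ = 1 → ∀ τ : ℝ, ∫ y in {y | inner ℝ e y ≤ τ}, f y = 0) :
    f = 0 := by
  have : Nonempty (Fin n) := ⟨⟨0, hn⟩⟩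
  set μ := volume.withDensity fun y => ENNReal.ofReal (f y)
  set ν := volume.withDensity fun y => ENNReal.ofReal (-f y)
  have hμ : IsFiniteMeasure μ := isFiniteMeasure_withDensity_ofReal hfi.2
  have hν : IsFiniteMeasure ν := isFiniteMeasure_withDensity_ofReal hfi.neg.2
  have hmarg : ∀ e : EuclideanSpace ℝ (Fin n), ‖e‖ = 1 →
      μ.map (fun y => inner ℝ e y) = ν.map (fun y => inner ℝ e y) := fun e he => by
    have hme : Measurable fun y : EuclideanSpace ℝ (Fin n) => inner ℝ e y := by fun_prop
    refine Measure.ext_of_Iic _ _ fun τ => ?_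
    have hS : MeasurableSet {y : EuclideanSpace ℝ (Fin n) | inner ℝ e y ≤ τ} :=
      hme measurableSet_Iic
    rw [Measure.map_apply hme measurableSet_Iic, Measure.map_apply hme measurableSet_Iic]
    change μ {y | inner ℝ e y ≤ τ} = ν {y | inner ℝ e y ≤ τ}
    have h0 := h e he τ
    rw [integral_eq_lintegral_pos_part_sub_lintegral_neg_part hfi.integrableOn, sub_eq_zero,
      ← withDensity_apply _ hS, ← withDensity_apply _ hS,
      ENNReal.toReal_eq_toReal_iff' (measure_ne_top μ _) (measure_ne_top ν _)] at h0
    exact h0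
  have heq : μ = ν := by
    refine Measure.ext_of_charFun (funext fun ξ => ?_)
    obtain ⟨c, e, he, rfl⟩ : ∃ (c : ℝ) (e : EuclideanSpace ℝ (Fin n)), ‖e‖ = 1 ∧ ξ = c • e := by
      by_cases hξ : ξ = 0
      · exact ⟨0, EuclideanSpace.single ⟨0, hn⟩ 1, by simp, by simp [hξ]⟩
      · exact ⟨‖ξ‖, ‖ξ‖⁻¹ • ξ, by simp [norm_smul, hξ], by simp [smul_smul, hξ]⟩
    have h1 := hmarg e he
    have h2 : ∀ ρ : Measure (EuclideanSpace ℝ (Fin n)),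
        charFun ρ (c • e) = charFun (ρ.map fun y => inner ℝ e y) c := fun ρ => by
      rw [charFun_apply, charFun_apply_real, integral_map (by fun_prop)
        (by fun_prop : Continuous _).aestronglyMeasurable]
      simp [inner_smul_right, real_inner_comm]
    rw [h2, h2, h1]
  have hae : f =ᵐ[volume] 0 := by
    have := (withDensity_eq_iff (by fun_prop) (by fun_prop) (measure_ne_top μ univ |> fun h => by
      simpa [μ] using h)).1 heq
    filter_upwards [this] with y hy
    rcases le_total 0 (f y) with h0 | h0
    · rw [ENNReal.ofReal_of_nonpos (neg_nonpos.2 h0), ENNReal.ofReal_eq_zero] at hy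
      exact le_antisymm hy h0
    · rw [ENNReal.ofReal_of_nonpos h0, eq_comm, ENNReal.ofReal_eq_zero] at hy
      exact le_antisymm h0 (neg_nonpos.1 hy)
  exact Continuous.ae_eq_iff_eq volume hf continuous_zero |>.1 hae

/-! ### Plane-wave kernels are orthogonal to polynomially integrable domains -/

lemma exists_mem_hyperplane_of_mem_convexHull {n : ℕ} {D : Set (EuclideanSpace ℝ (Fin n))}
    (hD : IsPreconnected D) (e : EuclideanSpace ℝ (Fin n)) {q : EuclideanSpace ℝ (Fin n)}
    (hq : q ∈ convexHull ℝ D) : (D ∩ hyperplane e (inner ℝ e q)).Nonempty := by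
  have hconv : Convex ℝ ((fun x => inner ℝ e x) '' D) :=
    (hD.image _ (by fun_prop)).ordConnected.convex
  have hsub : convexHull ℝ D ⊆ (innerSL ℝ e) ⁻¹' ((fun x => inner ℝ e x) '' D) :=
    convexHull_min (fun x hx => ⟨x, hx, by simp⟩)
      (hconv.linear_preimage (innerSL ℝ e).toLinearMap)
  obtain ⟨y, hy, hyq⟩ := hsub hq
  exact ⟨y, hy, by simpa [hyperplane] using hyq⟩

/-- Every hyperplane through a point `q` of the convex hull of `D` meets `D`, so the polynomial
formula for the section volume is available there. A kernel with profile `k⁽ᵐ⁾`, concentrated near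
a point `p` inside the convex hull, only sees such hyperplanes, and `k⁽ᵐ⁾` annihilates polynomials
of degree below `m`. -/
lemma setIntegral_planeWaveKernel_eq_zero {n : ℕ} {D : Set (EuclideanSpace ℝ (Fin n))}
    (hD : IsSmoothlyBoundedDomain D) {N : ℕ}
    {a : ℕ → Metric.sphere (0 : EuclideanSpace ℝ (Fin n)) 1 → ℝ}
    (ha : ∀ (ω : Metric.sphere (0 : EuclideanSpace ℝ (Fin n)) 1) (t : ℝ),
      (D ∩ hyperplane (ω : EuclideanSpace ℝ (Fin n)) t).Nonempty →
        sectionVolume D (ω : EuclideanSpace ℝ (Fin n)) t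
          = ∑ j ∈ Finset.range (N + 1), a j ω * t ^ j)
    {m : ℕ} {k : ℝ → ℝ} (hk : ContDiff ℝ m k) (hsupp : HasCompactSupport k) (hm : N < m)
    (hk1 : ∀ t, iteratedDeriv m k t ≠ 0 → |t| ≤ 1)
    {p z : EuclideanSpace ℝ (Fin n)} {δ l : ℝ} (hball : Metric.ball p δ ⊆ convexHull ℝ D)
    (hl : 0 < l) (hlδ : l * (1 + ‖z‖) < δ) :
    ∫ y in D, planeWaveKernel (iteratedDeriv m k) (l⁻¹ • (y - p) - z) = 0 := by
  have hgc : Continuous (iteratedDeriv m k) := hk.continuous_iteratedDeriv m le_rfl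
  have hcs : HasCompactSupport (iteratedDeriv m k) :=
    HasCompactSupport.of_support_subset_isCompact (isCompact_Icc (a := (-1 : ℝ)) (b := 1))
      fun t ht => abs_le.1 (hk1 t ht)
  obtain ⟨C, hC⟩ := hgc.bounded_above_of_compact_support hcs
  have hfinA : IsFiniteMeasure (volume.restrict
      (Metric.ball (0 : EuclideanSpace ℝ (Fin n)) 2 \ Metric.ball 0 1)) :=
    ⟨by simpa using (measure_mono sdiff_subset).trans_lt measure_ball_lt_top⟩
  have hfinD : IsFiniteMeasure (volume.restrict D) :=
    ⟨by simpa using hD.isBounded.measure_lt_top⟩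
  unfold planeWaveKernel
  rw [integral_integral_swap]
  swap
  · refine Integrable.of_bound (Continuous.aestronglyMeasurable ?_) C (.of_forall fun q => hC _)
    unfold Function.uncurry
    fun_prop
  refine setIntegral_eq_zero_of_forall_eq_zero fun ω hω => ?_
  have hω1 : 1 ≤ ‖ω‖ := by simpa using hω.2
  have hω0 : ‖ω‖ ≠ 0 := by positivity
  set e : EuclideanSpace ℝ (Fin n) := ‖ω‖⁻¹ • ω with he_def
  have he : ‖e‖ = 1 := by rw [he_def, norm_smul, norm_inv, norm_norm, inv_mul_cancel₀ hω0]
  have hωe : ω = ‖ω‖ • e := by rw [he_def, smul_inv_smul₀ hω0]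
  set b : ℝ := -(‖ω‖ / l * inner ℝ e p) - ‖ω‖ * inner ℝ e z with hb
  have hrw : ∀ y, iteratedDeriv m k (inner ℝ (l⁻¹ • (y - p) - z) ω)
      = (fun t => iteratedDeriv m k (‖ω‖ / l * t + b)) (inner ℝ e y) := fun y => by
    simp only
    congr 1
    conv_lhs => rw [hωe]
    rw [inner_smul_right, inner_sub_left, real_inner_smul_left, inner_sub_left,
      real_inner_comm e y, real_inner_comm e p, real_inner_comm e z, hb]
    ring
  simp_rw [hrw]
  rw [setIntegral_comp_inner (g := fun t => iteratedDeriv m k (‖ω‖ / l * t + b)) he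
    hD.isOpen.measurableSet hD.isBounded (by fun_prop)]
  have hes : e ∈ Metric.sphere (0 : EuclideanSpace ℝ (Fin n)) 1 := by simpa using he
  refine integral_mul_iteratedDeriv_comp_affine_eq_zero hk hsupp
    (Q := ∑ j ∈ Finset.range (N + 1), Polynomial.C (a j ⟨e, hes⟩) * Polynomial.X ^ j)
    ?_ (by positivity) fun t ht => ?_
  · refine lt_of_le_of_lt (Polynomial.natDegree_sum_le_of_forall_le _ _ fun j hj => ?_) hm
    exact (Polynomial.natDegree_C_mul_X_pow_le _ _).trans (Finset.mem_range_succ_iff.1 hj)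
  · have ht1 := hk1 _ ht
    -- the point of the hyperplane `⟨e, x⟩ = t` nearest to `p` lies in the convex hull
    have hdist : |t - inner ℝ e p| < δ := by
      have hbt : ‖ω‖ / l * t + b = ‖ω‖ * ((t - inner ℝ e p) / l - inner ℝ e z) := by
        rw [hb]; ring
      rw [hbt, abs_mul, abs_norm] at ht1
      have h1 : |(t - inner ℝ e p) / l - inner ℝ e z| ≤ 1 := by
        nlinarith [abs_nonneg ((t - inner ℝ e p) / l - inner ℝ e z)]
      have h2 : |inner ℝ e z| ≤ ‖z‖ := by simpa [he] using abs_real_inner_le_norm e z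
      have h3 : |(t - inner ℝ e p) / l| ≤ 1 + ‖z‖ := by
        have := abs_sub_abs_le_abs_sub ((t - inner ℝ e p) / l) (inner ℝ e z)
        linarith
      rw [abs_div, abs_of_pos hl, div_le_iff₀ hl] at h3
      linarith
    have hq : p + (t - inner ℝ e p) • e ∈ convexHull ℝ D :=
      hball (by simpa [norm_smul, he] using hdist)
    have hne := exists_mem_hyperplane_of_mem_convexHull hD.isConnected.isPreconnected e hq
    have hqt : inner ℝ e (p + (t - inner ℝ e p) • e) = t := by
      rw [inner_add_right, inner_smul_right, real_inner_self_eq_norm_sq, he]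
      ring
    rw [hqt] at hne
    simpa [Polynomial.eval_finsetSum] using ha ⟨e, hes⟩ t hne

/-! ### Blow-up at a boundary point -/

/-- If the sets `l⁻¹ • (D - p)` are orthogonal to a compactly supported function `f` as `l → 0`,
so is their limit, the tangent half-space of `D` at `p`. -/
lemma setIntegral_halfSpace_eq_zero_of_blowup {n : ℕ} {D : Set (EuclideanSpace ℝ (Fin n))}
    (hD : IsOpen D) {p : EuclideanSpace ℝ (Fin n)} (hp : p ∈ frontier D)
    {U : Set (EuclideanSpace ℝ (Fin n))} {ρ : EuclideanSpace ℝ (Fin n) → ℝ} (hU : IsOpen U)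
    (hpU : p ∈ U) (hρ : DifferentiableAt ℝ ρ p) (hρ0 : fderiv ℝ ρ p ≠ 0)
    (hDU : D ∩ U = {x ∈ U | ρ x < 0}) {f : EuclideanSpace ℝ (Fin n) → ℝ} (hf : Integrable f)
    (h : ∀ᶠ l in 𝓝[>] (0 : ℝ), ∫ y in D, f (l⁻¹ • (y - p)) = 0) :
    ∫ y in {y | fderiv ℝ ρ p y ≤ 0}, f y = 0 := by
  set L := fderiv ℝ ρ p
  have hmem : ∀ x ∈ U, (x ∈ D ↔ ρ x < 0) := fun x hx => by
    have := Set.ext_iff.1 hDU x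
    simp only [mem_inter_iff, mem_ofPred_eq, hx, and_true, true_and] at this
    exact this
  have hρp : ρ p = 0 := by
    refine le_antisymm ?_ ?_
    · by_contra! hpos
      have hev : ∀ᶠ x in 𝓝 p, x ∉ D := by
        filter_upwards [hU.mem_nhds hpU, hρ.continuousAt.eventually (lt_mem_nhds hpos)]
          with x hxU hx hxD
        exact lt_asymm hx ((hmem x hxU).1 hxD)
      exact (mem_closure_iff_frequently.1 hp.1) hev
    · by_contra! hneg
      have : p ∈ D := (hmem p hpU).2 hneg
      rw [hD.frontier_eq] at hp
      exact hp.2 this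
  have hLS : MeasurableSet {y : EuclideanSpace ℝ (Fin n) | L y ≤ 0} :=
    measurableSet_le L.continuous.measurable measurable_const
  -- the hypothesis in rescaled coordinates: `f` integrates to zero over `l⁻¹ • (D - p)`
  have hscale : ∀ᶠ l in 𝓝[>] (0 : ℝ),
      ∫ y, ((fun y => p + l • y) ⁻¹' D).indicator f y = 0 := by
    filter_upwards [h, self_mem_nhdsWithin] with l hl hl0
    have hl0' : l ≠ 0 := ne_of_gt hl0
    have h1 : ∀ y, ((fun y => p + l • y) ⁻¹' D).indicator f y
        = (fun x => (fun u => D.indicator (fun y => f (l⁻¹ • (y - p))) u) (p + x)) (l • y) :=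
      fun y => by
        by_cases hy : p + l • y ∈ D
        · rw [indicator_of_mem (by exact hy)]
          simp [hy, smul_smul, hl0']
        · rw [indicator_of_notMem (by exact hy)]
          simp [hy]
    simp_rw [h1]
    rw [Measure.integral_comp_smul volume
      (fun x => (fun u => D.indicator (fun y => f (l⁻¹ • (y - p))) u) (p + x)) l,
      integral_add_left_eq_self (fun u => D.indicator (fun y => f (l⁻¹ • (y - p))) u) p,
      integral_indicator hD.measurableSet, hl, smul_zero]
  have hnull : ∀ᵐ y : EuclideanSpace ℝ (Fin n), L y ≠ 0 := by
    have hker : (LinearMap.ker L.toLinearMap) ≠ ⊤ := fun htop => by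
      refine hρ0 (ContinuousLinearMap.ext fun y => ?_)
      have : y ∈ LinearMap.ker L.toLinearMap := htop ▸ Submodule.mem_top
      simpa using this
    have := Measure.addHaar_submodule (volume : Measure (EuclideanSpace ℝ (Fin n))) _ hker
    refine measure_mono_null (fun y hy => ?_) this
    simpa using hy
  have hlim : Tendsto (fun l : ℝ => ∫ y, ((fun y => p + l • y) ⁻¹' D).indicator f y) (𝓝[>] 0)
      (𝓝 (∫ y, {y | L y ≤ 0}.indicator f y)) := by
    refine tendsto_integral_filter_of_dominated_convergence (fun y => ‖f y‖) ?_ ?_ hf.norm ?_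
    · refine .of_forall fun l => hf.aestronglyMeasurable.indicator ?_
      exact hD.measurableSet.preimage (by fun_prop)
    · exact .of_forall fun l => .of_forall fun y => norm_indicator_le_norm_self _ _
    · filter_upwards [hnull] with y hy
      have hslope : Tendsto (fun l : ℝ => l⁻¹ • (ρ (p + l • y) - ρ p)) (𝓝[>] 0) (𝓝 (L y)) :=
        (hρ.hasFDerivAt.hasLineDerivAt y).tendsto_slope_zero_right
      have hUev : ∀ᶠ l in 𝓝[>] (0 : ℝ), p + l • y ∈ U := by
        have hc : Tendsto (fun l : ℝ => p + l • y) (𝓝[>] 0) (𝓝 p) := by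
          have : Continuous fun l : ℝ => p + l • y := by fun_prop
          simpa using (this.tendsto 0).mono_left nhdsWithin_le_nhds
        exact hc (hU.mem_nhds hpU)
      refine tendsto_const_nhds.congr' ?_
      rcases lt_or_gt_of_ne hy with hneg | hpos
      · filter_upwards [hslope.eventually (gt_mem_nhds hneg), hUev, self_mem_nhdsWithin]
          with l hl hlU hl0
        have hlt : ρ (p + l • y) < 0 := by
          rw [hρp, sub_zero, smul_eq_mul] at hl
          exact (pos_iff_neg_of_mul_neg hl).1 (inv_pos.2 hl0)
        rw [indicator_of_mem (by exact hneg.le), indicator_of_mem (by exact (hmem _ hlU).2 hlt)]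
      · filter_upwards [hslope.eventually (lt_mem_nhds hpos), hUev, self_mem_nhdsWithin]
          with l hl hlU hl0
        have hlt : 0 < ρ (p + l • y) := by
          rw [hρp, sub_zero, smul_eq_mul] at hl
          exact (pos_iff_pos_of_mul_pos hl).1 (inv_pos.2 hl0)
        rw [indicator_of_notMem (by simpa using hpos),
          indicator_of_notMem (by exact fun hx => lt_asymm hlt ((hmem _ hlU).1 hx))]
  have h0 : Tendsto (fun l : ℝ => ∫ y, ((fun y => p + l • y) ⁻¹' D).indicator f y) (𝓝[>] 0)
      (𝓝 0) := tendsto_const_nhds.congr' (hscale.mono fun l hl => hl.symm)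
  rw [← integral_indicator hLS]
  exact tendsto_nhds_unique hlim h0

/-! ### Rotation invariance and the conclusion -/

/-- For a rotation-invariant function, the half-space integrals in one direction determine those
in all directions. -/
lemma setIntegral_halfSpace_eq_of_linearIsometryEquiv_invariant {n : ℕ}
    {f : EuclideanSpace ℝ (Fin n) → ℝ}
    (hf : ∀ (T : EuclideanSpace ℝ (Fin n) ≃ₗᵢ[ℝ] EuclideanSpace ℝ (Fin n)) x, f (T x) = f x)
    {e e' : EuclideanSpace ℝ (Fin n)} (h : ‖e‖ = ‖e'‖) (τ : ℝ) :
    ∫ y in {y | inner ℝ e y ≤ τ}, f y = ∫ y in {y | inner ℝ e' y ≤ τ}, f y := by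
  set T : EuclideanSpace ℝ (Fin n) ≃ₗᵢ[ℝ] EuclideanSpace ℝ (Fin n) :=
    (ℝ ∙ (e - e'))ᗮ.reflection
  have hT : T e = e' := Submodule.reflection_sub h
  rw [← T.measurePreserving.setIntegral_preimage_emb T.toHomeomorph.measurableEmbedding f
    {y | inner ℝ e' y ≤ τ}]
  have hpre : T ⁻¹' {y | inner ℝ e' y ≤ τ} = {y | inner ℝ e y ≤ τ} := by
    ext y
    simp [← hT]
  rw [hpre]
  simp [hf]

theorem theoremT (n : ℕ) (hn : Odd n) (D : Set (EuclideanSpace ℝ (Fin n)))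
    (hD : IsSmoothlyBoundedDomain D) (hpoly : PolynomiallyIntegrable D) :
    Convex ℝ D := by
  obtain ⟨N, a, ha⟩ := hpoly
  -- the order must exceed `N` (section volumes of `D`) and `n` (section volumes of balls)
  obtain ⟨k, hk, hsupp, hk0, hk1⟩ := exists_contDiff_iteratedDeriv_ne_zero (N + n + 1)
  set g := iteratedDeriv (N + n + 1) k
  have hgc : Continuous g := hk.continuous_iteratedDeriv _ le_rfl
  have hcs : HasCompactSupport g :=
    HasCompactSupport.of_support_subset_isCompact (isCompact_Icc (a := (-1 : ℝ)) (b := 1))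
      fun t ht => abs_le.1 (hk1 t ht)
  obtain ⟨C, hC⟩ := hgc.bounded_above_of_compact_support hcs
  have hψc : Continuous (planeWaveKernel (n := n) g) := continuous_planeWaveKernel hgc hC
  have hψi : Integrable (planeWaveKernel (n := n) g) := by
    refine hψc.integrable_of_hasCompactSupport
      (.of_support_subset_isCompact (isCompact_closedBall 0 1) fun x hx => ?_)
    by_contra hx1
    exact hx (planeWaveKernel_eq_zero_of_one_lt_norm hn hk hsupp (by omega) hk1
      (by simpa using hx1))
  -- a boundary point of `D` in the interior of the convex hull is impossible
  have hdisj : Disjoint (frontier D) (convexHull ℝ D) := by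
    refine Set.disjoint_left.2 fun p hp hpc => ?_
    obtain ⟨δ, hδ, hball⟩ := Metric.isOpen_iff.1 hD.isOpen.convexHull p hpc
    obtain ⟨U, ρ, hU, hpU, hρ, hρ0, hDU⟩ := hD.smoothBoundary p hp
    have hρd : DifferentiableAt ℝ ρ p :=
      (hρ.contDiffAt (hU.mem_nhds hpU)).differentiableAt (by simp)
    have hhalf : ∀ z, ∫ y in {y | fderiv ℝ ρ p y ≤ 0}, planeWaveKernel g (y - z) = 0 := fun z => by
      refine setIntegral_halfSpace_eq_zero_of_blowup (f := fun y => planeWaveKernel g (y - z))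
        hD.isOpen hp hU hpU hρd hρ0 hDU (hψi.comp_sub_right z) ?_
      have hlim : Tendsto (fun l : ℝ => l * (1 + ‖z‖)) (𝓝[>] 0) (𝓝 0) := by
        have : Continuous fun l : ℝ => l * (1 + ‖z‖) := by fun_prop
        simpa using (this.tendsto 0).mono_left nhdsWithin_le_nhds
      filter_upwards [hlim.eventually (gt_mem_nhds hδ), self_mem_nhdsWithin] with l hl hl0
      exact setIntegral_planeWaveKernel_eq_zero hD ha hk hsupp (by omega) hk1 hball hl0 hl
    set v := (InnerProductSpace.toDual ℝ (EuclideanSpace ℝ (Fin n))).symm (fderiv ℝ ρ p) with hv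
    have hvL : ∀ y, inner ℝ v y = fderiv ℝ ρ p y := fun y => by
      rw [hv, InnerProductSpace.toDual_symm_apply]
    have hv0 : v ≠ 0 := by simpa [hv] using hρ0
    have hv0' : 0 < ‖v‖ := norm_pos_iff.2 hv0
    have hzero := eq_zero_of_setIntegral_halfSpace_eq_zero hn.pos hψc hψi fun e he τ => by
      have hunit : ‖‖v‖⁻¹ • v‖ = 1 := by
        rw [norm_smul, norm_inv, norm_norm, inv_mul_cancel₀ hv0'.ne']
      rw [setIntegral_halfSpace_eq_of_linearIsometryEquiv_invariant
        planeWaveKernel_map_linearIsometryEquiv (he.trans hunit.symm)]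
      -- translating by `z` moves the tangent half-space to `⟨v, y⟩ ≤ τ ‖v‖`
      set z : EuclideanSpace ℝ (Fin n) := -(τ • ‖v‖⁻¹ • v)
      have hmp := (measurePreserving_add_right (volume : Measure (EuclideanSpace ℝ (Fin n))) z)
      rw [← hhalf z, ← hmp.setIntegral_preimage_emb (measurableEmbedding_addRight z)
        (fun y => planeWaveKernel g (y - z)) {y | fderiv ℝ ρ p y ≤ 0}]
      have hpre : (fun y => y + z) ⁻¹' {y | fderiv ℝ ρ p y ≤ 0}
          = {y | inner ℝ (‖v‖⁻¹ • v) y ≤ τ} := by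
        ext y
        have : inner ℝ v z = -(τ * ‖v‖) := by
          simp only [z, inner_neg_right, inner_smul_right, real_inner_self_eq_norm_sq]
          field_simp
        simp only [mem_preimage, mem_ofPred_eq, ← hvL, inner_add_right, this,
          real_inner_smul_left]
        rw [inv_mul_le_iff₀ hv0']
        constructor <;> intro <;> linarith
      rw [hpre]
      simp
    exact planeWaveKernel_zero_ne_zero hn.pos hk0 (congrFun hzero 0)
  -- so `D` is open and relatively closed in its connected convex hull
  have hsub : convexHull ℝ D ⊆ D := by
    have hpre := (convex_convexHull ℝ D).isPreconnected
    obtain ⟨x, hx⟩ := hD.isConnected.nonempty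
    refine hpre.subset_left_of_subset_union hD.isOpen isClosed_closure.isOpen_compl
      (disjoint_compl_right_iff_subset.2 subset_closure) (fun y hy => ?_)
      ⟨x, subset_convexHull ℝ D hx, hx⟩
    by_cases hyD : y ∈ D
    · exact Or.inl hyD
    · refine Or.inr fun hyc => Set.disjoint_left.1 hdisj ?_ hy
      rw [hD.isOpen.frontier_eq]
      exact ⟨hyc, hyD⟩
  rw [← hsub.antisymm (subset_convexHull ℝ D)]
  exact convex_convexHull ℝ D
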